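/- Let $G$ be a finite simple connected bipartite graph with at least two vertices. A maximum stable set is an independent set of vertices of maximum cardinality $\alpha(G)$. The graph $G$ is $\alpha^+$-stable if $\alpha(G+e)=\alpha(G)$ for every edge $e$ of the complement $\overline{G}$. A graph $H$ is bistable bipartite if it has a bipartition $V(H)=A\sqcup B$ into stable sets such that $A\neq B$ and the maximum stable sets of $H$ are exactly $A$ and $B$. Then $G$ is $\alpha^+$-stable if and only if there are $k\ge 1$ and pairwise vertex-disjoint subgraphs $G_1,\dots,G_k$ of $G$ with $V(G)=V(G_1)\cup\dots\cup V(G_k)$ such that every $G_i$ is bistable bipartite (edges of $G$ between different $G_i$ are allowed). The same equivalence holds if the subgraphs $G_i$ are required to be induced. -/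

import Mathlib

/-- `G` is `α⁺`-stable: adding any edge of the complement does not change the stability number. -/
def IsAlphaPlusStable {V : Type*} (G : SimpleGraph V) : Prop :=
  ∀ e ∈ Gᶜ.edgeSet, (G ⊔ SimpleGraph.fromEdgeSet {e}).indepNum = G.indepNum

/-- `G` is bistable bipartite: it has a bipartition `{A, B}` of its vertex set such that the
maximum stable sets of `G` are exactly the two (distinct) sets `A` and `B`. -/
def IsBistableBipartite {V : Type*} [Finite V] (G : SimpleGraph V) : Prop :=
  ∃ A B : Finset V, G.IsBipartiteWith (A : Set V) (B : Set V) ∧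
    (A : Set V) ∪ (B : Set V) = Set.univ ∧ A ≠ B ∧
    ∀ S : Finset V, G.IsMaximumIndepSet S ↔ S = A ∨ S = B

/-- The subgraphs `H i` are pairwise vertex-disjoint and together cover all vertices of `G`.
Edges of `G` between different `H i` are allowed. -/
structure IsVertexDecomposition {V ι : Type*} {G : SimpleGraph V} (H : ι → G.Subgraph) :
    Prop where
  disjoint : ∀ i j, i ≠ j → Disjoint (H i).verts (H j).verts
  cover : ⋃ i, (H i).verts = Set.univ

/-! Both conditions amount to `2 * α ≤ |V|`, that is, to both colour classes X and Y being maximum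
stable sets. If G is `α⁺`-stable, recombining two maximum stable sets yields one with at most one
vertex in X; connectedness lets a neighbour in Y replace that vertex, so `α ≤ |Y|`, and
symmetrically `α ≤ |X|`. Hall's theorem then gives a perfect matching, whose edges are the parts.
Conversely, a stable set fills at most half of each bistable part, hence at most half of V. -/

open Finset

namespace SimpleGraph

variable {V : Type*} {G : SimpleGraph V}

/-- Two independent sets of a bipartite graph can be recombined: intersect them on one side and
unite them on the other. -/
theorem IsBipartiteWith.isIndepSet_recombine [DecidableEq V] {X Y S T : Finset V}
    (h : G.IsBipartiteWith (X : Set V) (Y : Set V))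
    (hS : G.IsIndepSet (S : Set V)) (hT : G.IsIndepSet (T : Set V)) :
    G.IsIndepSet (((S ∩ T) ∩ X ∪ (S ∪ T) ∩ Y : Finset V) : Set V) := by
  have hd : ∀ z, z ∈ X → z ∉ Y := fun z h1 h2 => Set.disjoint_left.mp h.disjoint h1 h2
  have key : ∀ u v, u ∈ (S ∩ T) ∩ X → v ∈ S ∪ T → ¬G.Adj u v := by
    intro u v hu hv huv
    simp only [mem_inter, mem_union] at hu hv
    rcases hv with hv | hv
    · exact hS hu.1.1 hv huv.ne huv
    · exact hT hu.1.2 hv huv.ne huv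
  intro u hu v hv _ huv
  have hm := h.mem_of_adj huv
  simp only [mem_coe] at hm hu hv
  rcases hm with ⟨h1, h2⟩ | ⟨h1, h2⟩
  · have h3 : u ∈ (S ∩ T) ∩ X := by
      rcases mem_union.1 hu with h' | h'
      · exact h'
      · exact absurd (mem_inter.1 h').2 (hd u h1)
    have h4 : v ∈ S ∪ T := by
      simp only [mem_inter, mem_union] at hv ⊢; tauto
    exact key u v h3 h4 huv
  · have h3 : v ∈ (S ∩ T) ∩ X := by
      rcases mem_union.1 hv with h' | h'
      · exact h'
      · exact absurd (mem_inter.1 h').2 (hd v h2)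
    have h4 : u ∈ S ∪ T := by
      simp only [mem_inter, mem_union] at hu ⊢; tauto
    exact key v u h3 h4 huv.symm

theorem IsBipartiteWith.isIndepSet_left {X Y : Set V} (h : G.IsBipartiteWith X Y) :
    G.IsIndepSet X := fun _ hu _ hv _ huv =>
  Set.disjoint_left.mp h.disjoint hv (h.mem_of_mem_adj hu huv)

/-- On each side of the bipartition the two recombinations use `S ∩ T` and `S ∪ T` once each. -/
theorem IsBipartiteWith.card_recombine [Fintype V] [DecidableEq V] {X Y S T : Finset V}
    (h : G.IsBipartiteWith (X : Set V) (Y : Set V)) (hU : X ∪ Y = univ) :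
    #((S ∩ T) ∩ X ∪ (S ∪ T) ∩ Y) + #((S ∩ T) ∩ Y ∪ (S ∪ T) ∩ X) = #S + #T := by
  have hd : Disjoint X Y := by simpa using h.disjoint
  have split : ∀ R : Finset V, #(R ∩ X) + #(R ∩ Y) = #R := by
    intro R
    rw [← card_union_of_disjoint (hd.mono inter_subset_right inter_subset_right),
      ← inter_union_distrib_left, hU, inter_univ]
  rw [card_union_of_disjoint (hd.mono inter_subset_right inter_subset_right),
    card_union_of_disjoint (hd.symm.mono inter_subset_right inter_subset_right)]
  have h1 := split (S ∩ T)
  have h2 := split (S ∪ T)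
  have h3 := card_union_add_card_inter S T
  omega

/-- In an `α⁺`-stable connected bipartite graph every colour class is a maximum independent set. -/
theorem IsBipartiteWith.indepNum_le_of_isAlphaPlusStable [Fintype V] [DecidableEq V] [Nontrivial V]
    {X Y : Finset V} (h : G.IsBipartiteWith (X : Set V) (Y : Set V)) (hU : X ∪ Y = univ)
    (hconn : G.Connected) (hst : IsAlphaPlusStable G) : G.indepNum ≤ #Y := by
  have hcov : ∀ z, z ∉ X → z ∈ Y := fun z hz => by
    have : z ∈ X ∪ Y := hU ▸ mem_univ z
    exact (mem_union.1 this).resolve_left hz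
  classical
  obtain ⟨S, hS, hmin⟩ := exists_min_image
    ({S | G.IsNIndepSet G.indepNum S} : Finset (Finset V)) (fun S => #(S ∩ X)) (by
      obtain ⟨s, hs⟩ := G.exists_isNIndepSet_indepNum
      exact ⟨s, by simpa using hs⟩)
  simp only [mem_filter, mem_univ, true_and] at hS hmin
  rcases Nat.lt_or_ge 1 #(S ∩ X) with h1 | h1
  · exfalso
    obtain ⟨x, hx, y, hy, hxy⟩ := one_lt_card.1 h1
    have hnadj : ¬G.Adj x y :=
      h.isIndepSet_left (mem_inter.1 hx).2 (mem_inter.1 hy).2 hxy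
    have hα := hst s(x, y) (by simp [hxy, hnadj])
    obtain ⟨T, hT⟩ := (G ⊔ fromEdgeSet {s(x, y)}).exists_isNIndepSet_indepNum
    rw [hα] at hT
    have hTG : G.IsIndepSet (T : Set V) := fun u hu v hv huv hadj =>
      hT.isIndepSet hu hv huv (Or.inl hadj)
    have hnot : ¬(x ∈ T ∧ y ∈ T) := fun ⟨hxT, hyT⟩ =>
      hT.isIndepSet hxT hyT hxy (Or.inr (by simp [hxy]))
    have hP := h.isIndepSet_recombine hS.isIndepSet hTG
    have hQ := h.symm.isIndepSet_recombine hS.isIndepSet hTG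
    have hPQ := h.card_recombine hU (S := S) (T := T)
    have hPle := hP.card_le_indepNum
    have hQle := hQ.card_le_indepNum
    have hSc := hS.card_eq
    have hTc := hT.card_eq
    -- The two recombinations have total size 2α and each has size at most α, so both are maximum.
    -- The first meets X only inside `S ∩ T`, which misses x or y, against the minimality of S.
    have hle := hmin _ ⟨hP, by omega⟩
    refine absurd hle (not_le.2 (card_lt_card ?_))
    have hsub : (S ∩ T ∩ X ∪ (S ∪ T) ∩ Y) ∩ X ⊆ S ∩ T ∩ X := by
      intro z hz
      obtain ⟨hz1, hz2⟩ := mem_inter.1 hz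
      rcases mem_union.1 hz1 with h' | h'
      · exact h'
      · exact (Set.disjoint_left.mp h.disjoint hz2 (mem_inter.1 h').2).elim
    refine ⟨fun z hz => ?_, fun hc => hnot ⟨?_, ?_⟩⟩
    · have := hsub hz
      simp only [mem_inter] at this ⊢
      tauto
    · have := hsub (hc hx)
      simp only [mem_inter] at this
      tauto
    · have := hsub (hc hy)
      simp only [mem_inter] at this
      tauto
  · rcases (S ∩ X).eq_empty_or_nonempty with h0 | ⟨x, hx⟩
    · rw [← hS.card_eq]
      refine card_le_card fun z hz => hcov z fun hzX => ?_
      have : z ∈ S ∩ X := mem_inter.2 ⟨hz, hzX⟩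
      simp [h0] at this
    · obtain ⟨y, hxy⟩ := hconn.preconnected.exists_adj_of_nontrivial x
      have hyY : y ∈ Y := h.mem_of_mem_adj (mem_inter.1 hx).2 hxy
      have hyS : y ∉ S := fun hy => hS.isIndepSet (mem_inter.1 hx).1 hy hxy.ne hxy
      -- Since x is the only vertex of S in X and y is not in S, trading x for y bounds `#S` by
      -- `#Y`.
      have hsub : S ⊆ insert x (Y.erase y) := by
        intro z hz
        by_cases hzX : z ∈ X
        · exact mem_insert.2 (Or.inl (card_le_one.1 h1 z (mem_inter.2 ⟨hz, hzX⟩) x hx))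
        · exact mem_insert_of_mem (mem_erase.2 ⟨fun e => hyS (e ▸ hz), hcov z hzX⟩)
      have := (card_le_card hsub).trans (card_insert_le _ _)
      rwa [card_erase_add_one hyY, hS.card_eq] at this

/-- If a colour class of a bipartite graph is a maximum independent set, then the other one can be
matched into it. -/
theorem IsBipartiteWith.exists_injective_adj [Fintype V] [DecidableEq V]
    {X Y : Finset V} (h : G.IsBipartiteWith (X : Set V) (Y : Set V)) (hY : G.indepNum ≤ #Y) :
    ∃ f : X → V, Function.Injective f ∧ ∀ x : X, G.Adj x (f x) := by
  classical
  have hall := (Finset.all_card_le_biUnion_card_iff_exists_injective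
    (fun x : X => ({v | G.Adj x v} : Finset V))).1 ?_
  · simpa using hall
  intro A
  set N := A.biUnion (fun x : X => ({v | G.Adj x v} : Finset V)) with hN
  have hmemN : ∀ (x : X) v, x ∈ A → G.Adj x v → v ∈ N := fun x v hx hv =>
    mem_biUnion.2 ⟨x, hx, by simpa using hv⟩
  set A' : Finset V := A.map (Function.Embedding.subtype _) with hA'
  have hA'X : A' ⊆ X := by
    intro z hz
    obtain ⟨x, -, rfl⟩ := mem_map.1 hz
    exact x.2
  have hdXY : Disjoint X Y := by simpa using h.disjoint
  have hnadj : ∀ u v, u ∈ A' → v ∈ Y \ N → ¬G.Adj u v := by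
    intro u v hu hv huv
    obtain ⟨x, hx, rfl⟩ := mem_map.1 hu
    exact (mem_sdiff.1 hv).2 (hmemN x v hx huv)
  -- Hall's condition: this stable set has size at most α ≤ `#Y`, so N has at least as many elements
  -- as A.
  have hind : G.IsIndepSet ((A' ∪ Y \ N : Finset V) : Set V) := by
    intro u hu v hv hne huv
    rcases mem_union.1 hu with hu | hu <;> rcases mem_union.1 hv with hv | hv
    · exact h.isIndepSet_left (hA'X hu) (hA'X hv) hne huv
    · exact hnadj u v hu hv huv
    · exact hnadj v u hv hu huv.symm
    · exact h.symm.isIndepSet_left (mem_sdiff.1 hu).1 (mem_sdiff.1 hv).1 hne huv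
  have hc := hind.card_le_indepNum
  rw [card_union_of_disjoint (hdXY.mono hA'X sdiff_subset)] at hc
  have h1 : #A' = #A := card_map _
  have h2 := le_card_sdiff N Y
  omega

/-- An independent set covers at most half of the vertices of a bistable bipartite graph. -/
theorem IsIndepSet.two_mul_card_le_of_isBistableBipartite [Fintype V] (hG : IsBistableBipartite G)
    {S : Finset V} (hS : G.IsIndepSet (S : Set V)) : 2 * #S ≤ Fintype.card V := by
  classical
  obtain ⟨A, B, hAB, -, -, hmax⟩ := hG
  have hA := ((hmax A).2 (Or.inl rfl)).maximum S hS
  have hB := ((hmax B).2 (Or.inr rfl)).maximum S hS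
  have hd : Disjoint A B := by simpa using hAB.disjoint
  have := card_le_univ (A ∪ B)
  rw [card_union_of_disjoint hd] at this
  omega

theorem isBistableBipartite_of_adj [Finite V] {a b : V} (hab : G.Adj a b)
    (huniv : ∀ v, v = a ∨ v = b) : IsBistableBipartite G := by
  classical
  have hone : ∀ S : Finset V, G.IsIndepSet (S : Set V) → #S ≤ 1 := by
    intro S hS
    refine card_le_one.2 fun u hu v hv => ?_
    by_contra hne
    apply hS hu hv hne
    rcases huniv u with rfl | rfl <;> rcases huniv v with rfl | rfl
    · exact absurd rfl hne
    · exact hab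
    · exact hab.symm
    · exact absurd rfl hne
  have hsing : ∀ v, G.IsMaximumIndepSet {v} := fun v =>
    ⟨by simp [IsIndepSet], fun t ht => by simpa using hone t ht⟩
  refine ⟨{a}, {b}, ⟨by simpa using hab.ne, ?_⟩, ?_, by simpa using hab.ne, fun S => ⟨?_, ?_⟩⟩
  · intro v w hvw
    have := hvw.ne
    simp only [coe_singleton, Set.mem_singleton_iff]
    rcases huniv v with rfl | rfl <;> rcases huniv w with rfl | rfl <;> simp_all
  · ext v
    simpa [or_comm] using huniv v
  · intro hS
    have h1 := hS.maximum {a} (hsing a).isIndepSet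
    have h2 := hone S hS.isIndepSet
    obtain ⟨v, rfl⟩ := card_eq_one.1 (le_antisymm h2 (by simpa using h1))
    simpa using huniv v
  · rintro (rfl | rfl) <;> exact hsing _

end SimpleGraph

open SimpleGraph

theorem IsVertexDecomposition.card_eq_sum {V ι : Type*} [DecidableEq V] [Fintype ι]
    {G : SimpleGraph V} {H : ι → G.Subgraph} [∀ i, DecidablePred (· ∈ (H i).verts)]
    (hH : IsVertexDecomposition H) (S : Finset V) :
    #S = ∑ i, #{v ∈ S | v ∈ (H i).verts} := by
  rw [← card_biUnion]
  · congr 1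
    ext v
    have hv : v ∈ ⋃ i, (H i).verts := hH.cover ▸ Set.mem_univ v
    simpa using fun _ => hv
  · intro i _ j _ hij
    refine Finset.disjoint_left.2 fun v hi hj => ?_
    exact Set.disjoint_left.1 (hH.disjoint i j hij) (mem_filter.1 hi).2 (mem_filter.1 hj).2

theorem IsVertexDecomposition.two_mul_indepNum_le {V ι : Type*} [Fintype V] [Fintype ι]
    {G : SimpleGraph V} {H : ι → G.Subgraph} (hH : IsVertexDecomposition H)
    (hb : ∀ i, IsBistableBipartite (H i).coe) : 2 * G.indepNum ≤ Fintype.card V := by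
  classical
  obtain ⟨S, hS⟩ := G.exists_isNIndepSet_indepNum
  rw [← hS.card_eq, hH.card_eq_sum S, ← card_univ, hH.card_eq_sum univ, mul_sum]
  refine sum_le_sum fun i _ => ?_
  have hT : (H i).coe.IsIndepSet ((S.subtype (· ∈ (H i).verts) : Finset (H i).verts) : Set _) :=
    fun u hu v hv hne huv => hS.isIndepSet (mem_subtype.1 hu) (mem_subtype.1 hv)
      (fun e => hne (Subtype.ext e)) ((H i).adj_sub huv)
  have h1 := hT.two_mul_card_le_of_isBistableBipartite (hb i)
  rw [card_subtype, Fintype.card_subtype] at h1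
  exact h1

/-- The bound forces both classes to have size α, and a new edge cannot lie inside both, so one of
them stays stable. -/
theorem SimpleGraph.IsBipartiteWith.isAlphaPlusStable {V : Type*} [Fintype V] [DecidableEq V]
    {G : SimpleGraph V} {X Y : Finset V} (h : G.IsBipartiteWith (X : Set V) (Y : Set V))
    (hU : X ∪ Y = univ) (hα : 2 * G.indepNum ≤ Fintype.card V) : IsAlphaPlusStable G := by
  have hd : Disjoint X Y := by simpa using h.disjoint
  have hc := card_union_of_disjoint hd
  rw [hU, card_univ] at hc
  have hX := h.isIndepSet_left.card_le_indepNum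
  have hY := h.symm.isIndepSet_left.card_le_indepNum
  intro e he
  induction e using Sym2.ind with | _ x y
  set G' := G ⊔ fromEdgeSet {s(x, y)} with hG'
  apply le_antisymm
  · obtain ⟨T, hT⟩ := G'.exists_isNIndepSet_indepNum
    have hTG : G.IsIndepSet (T : Set V) := fun u hu v hv huv hadj =>
      hT.isIndepSet hu hv huv (Or.inl hadj)
    exact hT.card_eq ▸ hTG.card_le_indepNum
  · have key : ∀ S : Finset V, G.IsIndepSet (S : Set V) → ¬(x ∈ S ∧ y ∈ S) →
        #S ≤ G'.indepNum := by
      intro S hS hxy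
      refine IsIndepSet.card_le_indepNum (fun u hu v hv huv hadj => ?_)
      rcases hadj with hadj | hadj
      · exact hS hu hv huv hadj
      · simp only [fromEdgeSet_adj, Set.mem_singleton_iff, Sym2.eq_iff] at hadj
        rcases hadj.1 with ⟨rfl, rfl⟩ | ⟨rfl, rfl⟩
        · exact hxy ⟨hu, hv⟩
        · exact hxy ⟨hv, hu⟩
    by_cases hx : x ∈ X ∧ y ∈ X
    · have := key Y h.symm.isIndepSet_left fun hy => Finset.disjoint_left.1 hd hx.1 hy.1
      omega
    · have := key X h.isIndepSet_left hx
      omega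

/-- An `α⁺`-stable connected bipartite graph with at least two vertices has a perfect matching,
that is, a decomposition into induced copies of `K₂`. -/
theorem IsAlphaPlusStable.exists_decomposition {V : Type*} [Fintype V] [DecidableEq V]
    [Nontrivial V] {G : SimpleGraph V} {X Y : Finset V}
    (h : G.IsBipartiteWith (X : Set V) (Y : Set V)) (hU : X ∪ Y = univ) (hconn : G.Connected)
    (hst : IsAlphaPlusStable G) :
    ∃ (k : ℕ) (H : Fin k → G.Subgraph), 1 ≤ k ∧ IsVertexDecomposition H ∧
      ∀ i, (H i).IsInduced ∧ IsBistableBipartite (H i).coe := by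
  have hd : Disjoint X Y := by simpa using h.disjoint
  have hY := h.indepNum_le_of_isAlphaPlusStable hU hconn hst
  have hX := h.symm.indepNum_le_of_isAlphaPlusStable (by rwa [union_comm]) hconn hst
  have hYα := h.symm.isIndepSet_left.card_le_indepNum
  obtain ⟨f, hinj, hadj⟩ := h.exists_injective_adj hY
  have hfY : ∀ x, f x ∈ Y := fun x => h.mem_of_mem_adj x.2 (hadj x)
  -- The matching is perfect because `#Y ≤ α ≤ #X`.
  have himg : univ.image f = Y := by
    refine eq_of_subset_of_card_le (fun z hz => ?_) ?_
    · obtain ⟨x, -, rfl⟩ := mem_image.1 hz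
      exact hfY x
    · rw [card_image_of_injective _ hinj, card_univ, Fintype.card_coe]
      omega
  have e : Fin #X ≃ X := X.equivFin.symm
  have hXne : X.Nonempty := by
    rw [nonempty_iff_ne_empty]
    rintro rfl
    have hY0 : Y = ∅ := card_eq_zero.1 (by simp at hX; omega)
    obtain ⟨v⟩ := hconn.nonempty
    have : v ∈ (∅ ∪ Y : Finset V) := hU ▸ mem_univ v
    simp [hY0] at this
  refine ⟨#X, fun i => (⊤ : G.Subgraph).induce {(e i : V), f (e i)}, hXne.card_pos,
    ⟨fun i j hij => ?_, ?_⟩, fun i => ⟨?_, ?_⟩⟩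
  · rw [Set.disjoint_left]
    rintro v (rfl | rfl) (hv | hv)
    · exact hij (e.injective (Subtype.ext hv))
    · exact Finset.disjoint_left.1 hd (e i).2 (hv ▸ hfY _)
    · exact Finset.disjoint_left.1 hd (e j).2 (hv ▸ hfY _)
    · exact hij (e.injective (hinj hv))
  · refine Set.eq_univ_of_forall fun v => Set.mem_iUnion.2 ?_
    have hv : v ∈ X ∪ Y := hU ▸ mem_univ v
    rcases mem_union.1 hv with hv | hv
    · exact ⟨e.symm ⟨v, hv⟩, by simp⟩
    · rw [← himg] at hv
      obtain ⟨x, -, rfl⟩ := mem_image.1 hv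
      exact ⟨e.symm x, by simp⟩
  · exact fun v hv w hw hvw => ⟨hv, hw, hvw⟩
  · refine isBistableBipartite_of_adj
      (a := ⟨(e i : V), Or.inl rfl⟩) (b := ⟨f (e i), Or.inr rfl⟩) ?_ ?_
    · exact ⟨Or.inl rfl, Or.inr rfl, hadj _⟩
    · rintro ⟨v, rfl | rfl⟩
      · exact Or.inl rfl
      · exact Or.inr rfl

/-- A connected bipartite graph with at least two vertices is `α⁺`-stable if and only if it
decomposes into vertex-disjoint bistable bipartite subgraphs covering its vertices, and this is so
both for arbitrary subgraphs and for induced subgraphs as parts. -/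
theorem proposition5p7 {V : Type*} [Finite V] [Nontrivial V] (G : SimpleGraph V)
    (hconn : G.Connected) (hbip : G.IsBipartite) :
    (IsAlphaPlusStable G ↔
      ∃ (k : ℕ) (H : Fin k → G.Subgraph), 1 ≤ k ∧ IsVertexDecomposition H ∧
        ∀ i, IsBistableBipartite (H i).coe) ∧
    (IsAlphaPlusStable G ↔
      ∃ (k : ℕ) (H : Fin k → G.Subgraph), 1 ≤ k ∧ IsVertexDecomposition H ∧
        ∀ i, (H i).IsInduced ∧ IsBistableBipartite (H i).coe) := by
  classical
  have := Fintype.ofFinite V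
  obtain ⟨c⟩ := hbip
  obtain ⟨X, Y, h, hU⟩ : ∃ X Y : Finset V,
      G.IsBipartiteWith (X : Set V) (Y : Set V) ∧ X ∪ Y = univ := by
    refine ⟨univ.filter (c · = 0), univ.filter (c · ≠ 0), ⟨?_, fun v w hvw => ?_⟩, filter_union_filter_not_eq _ _⟩
    · rw [Set.disjoint_left]
      intro v hv hv'
      simp_all
    · have hne := c.valid hvw
      simp only [coe_filter, mem_univ, true_and, Set.mem_ofPred_eq]
      omega
  have hto := IsAlphaPlusStable.exists_decomposition h hU hconn
  have hof : (∃ (k : ℕ) (H : Fin k → G.Subgraph), 1 ≤ k ∧ IsVertexDecomposition H ∧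
      ∀ i, IsBistableBipartite (H i).coe) → IsAlphaPlusStable G :=
    fun ⟨_, _, _, hH, hb⟩ => h.isAlphaPlusStable hU (hH.two_mul_indepNum_le hb)
  refine ⟨⟨fun hs => ?_, hof⟩, ⟨hto, fun ⟨k, H, hk, hH, hb⟩ => hof ⟨k, H, hk, hH, fun i => (hb i).2⟩⟩⟩
  obtain ⟨k, H, hk, hH, hb⟩ := hto hs
  exact ⟨k, H, hk, hH, fun i => (hb i).2⟩
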